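/- Let $1\le p<\infty$, let $(e_j)_{j\in\mathbb Z}$ be the canonical basis of $\ell^p(\mathbb Z)$ (complex sequences), and let $K:\mathbb Z\times\mathbb Z\to\mathbb C$ satisfy $$\sum_{j\in\mathbb Z}\Big(\sum_{m\in\mathbb Z}|K(m,j)|^p\Big)^{1/p}<\infty .$$ Then there is exactly one bounded operator $T:\ell^p(\mathbb Z)\to\ell^p(\mathbb Z)$ with $K(i,j)=\langle Te_j,e_i\rangle=(Te_j)(i)$ for all $i,j\in\mathbb Z$, and $T$ is nuclear. Moreover there is $r>0$ such that for all $\lambda\in\mathbb C$ with $|\lambda|<r$ $$\operatorname{Det}(I+\lambda T)=\exp\Big(\sum_{m=1}^\infty\frac{(-1)^{m+1}}{m}\,\lambda^m\sum_{\substack{(j_0,\dots,j_m)\in\mathbb Z^{m+1}\\ j_0=j_m}}\ \prod_{s=1}^m K(j_{s-1},j_s)\Big),$$ where the inner sums (for all $m\ge1$) and the outer series converge absolutely. Here an operator $T$ on a Banach space $\mathcal B$ is nuclear if $Tx=\sum_n x_n'(x)\,y_n$ for all $x$, with $x_n'\in\mathcal B'$, $y_n\in\mathcal B$ and $\sum_n\|x_n'\|\|y_n\|<\infty$;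 the nuclear norm $N(T)$ is the infimum of these sums over all such decompositions of $T$. For $F$ bounded of finite rank, $\operatorname{Det}(I+F)=\det(I+F|_M)$, where $\mathcal B=M\oplus M'$ with $M$ finite-dimensional, $F(M)\subset M$ and $M'\subset\ker F$ (the value does not depend on the choice of $M,M'$). For $A$ nuclear, $\operatorname{Det}(I+A)=\lim_n\operatorname{Det}(I+F_n)$ for any finite rank operators $F_n$ with $N(A-F_n)\to0$; it is part of the assertion that for $A=\lambda T$ such sequences exist and that the limit exists and is the same for all of them. -/

import Mathlib

open scoped ENNReal Topology
open Filter

noncomputable section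

namespace NuclearDet

section Banach

variable {B : Type*} [NormedAddCommGroup B] [NormedSpace ℂ B]

/-- A nuclear decomposition `T = ∑ₙ xₙ' ⊗ yₙ` with `∑ₙ ‖xₙ'‖ ‖yₙ‖ < ∞`. -/
structure IsNuclearDecomposition (T : B →L[ℂ] B) (x' : ℕ → (B →L[ℂ] ℂ)) (y : ℕ → B) : Prop where
  summable : Summable fun n => ‖x' n‖ * ‖y n‖
  hasSum : ∀ x : B, HasSum (fun n => x' n x • y n) (T x)

/-- An operator is nuclear if it has a nuclear decomposition. -/
def IsNuclear (T : B →L[ℂ] B) : Prop :=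
  ∃ (x' : ℕ → (B →L[ℂ] ℂ)) (y : ℕ → B), IsNuclearDecomposition T x' y

/-- The nuclear norm `N(T) = inf ∑ₙ ‖xₙ'‖ ‖yₙ‖` over all nuclear decompositions of `T`
(it is `∞` when `T` is not nuclear). -/
def nuclearNorm (T : B →L[ℂ] B) : ℝ≥0∞ :=
  ⨅ (x' : ℕ → (B →L[ℂ] ℂ)) (y : ℕ → B) (_ : IsNuclearDecomposition T x' y),
    ∑' n, ‖x' n‖ₑ * ‖y n‖ₑ

/-- Bounded operators of finite rank. -/
def IsFiniteRank (F : B →L[ℂ] B) : Prop :=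
  FiniteDimensional ℂ (LinearMap.range (F : B →ₗ[ℂ] B))

/-- `Det(I + F)` for `F` of finite rank: the determinant of `I + F` restricted to the range of `F`.
By `finiteRankDet_eq` below it equals the determinant of `I + F` on `M`, for every decomposition
`B = M ⊕ N` with `M` finite dimensional and invariant under `F`, and `N` in the kernel of `F`. -/
def finiteRankDet (F : B →L[ℂ] B) : ℂ :=
  LinearMap.det (1 + (F : B →ₗ[ℂ] B).restrict
    (p := LinearMap.range (F : B →ₗ[ℂ] B)) (q := LinearMap.range (F : B →ₗ[ℂ] B))
    (fun x _ => LinearMap.mem_range_self _ x))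

theorem det_one_add_comp_comm {V W : Type*} [AddCommGroup V] [Module ℂ V] [FiniteDimensional ℂ V]
    [AddCommGroup W] [Module ℂ W] [FiniteDimensional ℂ W] (f : V →ₗ[ℂ] W) (g : W →ₗ[ℂ] V) :
    LinearMap.det (1 + g ∘ₗ f) = LinearMap.det (1 + f ∘ₗ g) := by
  classical
  let b := Module.finBasis ℂ V
  let c := Module.finBasis ℂ W
  rw [← LinearMap.det_toMatrix b, ← LinearMap.det_toMatrix c, map_add, map_add,
    LinearMap.toMatrix_comp b c b, LinearMap.toMatrix_comp c b c, LinearMap.toMatrix_one,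
    LinearMap.toMatrix_one, Matrix.det_one_add_mul_comm]

theorem finiteRankDet_eq (F : B →L[ℂ] B) (M N : Submodule ℂ B) [FiniteDimensional ℂ M]
    (hMN : IsCompl M N) (hM : ∀ x ∈ M, (F : B →ₗ[ℂ] B) x ∈ M)
    (hN : N ≤ LinearMap.ker (F : B →ₗ[ℂ] B)) :
    finiteRankDet F = LinearMap.det (1 + (F : B →ₗ[ℂ] B).restrict (p := M) (q := M) hM) := by
  have hle : LinearMap.range (F : B →ₗ[ℂ] B) ≤ M := by
    rintro _ ⟨x, rfl⟩
    obtain ⟨m, hm, n, hn, rfl⟩ := Submodule.mem_sup.1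
      (show x ∈ M ⊔ N from hMN.sup_eq_top ▸ Submodule.mem_top)
    have h0 : (F : B →ₗ[ℂ] B) n = 0 := hN hn
    rw [map_add, h0, add_zero]
    exact hM m hm
  have : FiniteDimensional ℂ (LinearMap.range (F : B →ₗ[ℂ] B)) :=
    Submodule.finiteDimensional_of_le hle
  exact det_one_add_comp_comm (Submodule.inclusion hle)
    ((F : B →ₗ[ℂ] B).rangeRestrict ∘ₗ M.subtype)

/-- `F` is a sequence of finite rank operators that converges to `A` in the nuclear norm. -/
def Approximates (F : ℕ → (B →L[ℂ] B)) (A : B →L[ℂ] B) : Prop :=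
  (∀ n, IsFiniteRank (F n)) ∧ Tendsto (fun n => nuclearNorm (A - F n)) atTop (𝓝 0)

/-- `d` is the determinant `Det(I + A)` in the algebra of nuclear operators: `A` is a limit in the
nuclear norm of finite rank operators, and for every such sequence `Fₙ → A` one has
`Det(I + Fₙ) → d`. There is at most one such `d`. -/
def HasNuclearDet (A : B →L[ℂ] B) (d : ℂ) : Prop :=
  (∃ F : ℕ → (B →L[ℂ] B), Approximates F A) ∧
    ∀ F : ℕ → (B →L[ℂ] B), Approximates F A →
      Tendsto (fun n => finiteRankDet (F n)) atTop (𝓝 d)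

theorem HasNuclearDet.unique {A : B →L[ℂ] B} {d d' : ℂ} (h : HasNuclearDet A d)
    (h' : HasNuclearDet A d') : d = d' := by
  obtain ⟨F, hF⟩ := h.1
  exact tendsto_nhds_unique (h.2 F hF) (h'.2 F hF)

end Banach

/-- `T` has the matrix `K` in the canonical basis: `K(i, j) = ⟨T eⱼ, eᵢ⟩ = (T eⱼ)(i)`. -/
def HasKernel {p : ℝ≥0∞} [Fact (1 ≤ p)]
    (T : lp (fun _ : ℤ => ℂ) p →L[ℂ] lp (fun _ : ℤ => ℂ) p) (K : ℤ → ℤ → ℂ) : Prop :=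
  ∀ i j : ℤ, T (lp.single p j (1 : ℂ)) i = K i j

/-- Closed chains `(j₀, j₁, …, jₘ)` of integers with `j₀ = jₘ`. -/
def ClosedChain (m : ℕ) : Type :=
  {j : Fin (m + 1) → ℤ // j 0 = j (Fin.last m)}

/-- The product `K(j₀, j₁) K(j₁, j₂) ⋯ K(jₘ₋₁, jₘ)` along a chain. -/
def chainProd (K : ℤ → ℤ → ℂ) {m : ℕ} (j : ClosedChain m) : ℂ :=
  ∏ s : Fin m, K (j.1 s.castSucc) (j.1 s.succ)

/-- The term `((-1)^(m+1) / m) λ^m ∑_{j₀ = jₘ} ∏ₛ K(jₛ₋₁, jₛ)` (used for `m ≥ 1`). -/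
def plemeljTerm (K : ℤ → ℤ → ℂ) (z : ℂ) (m : ℕ) : ℂ :=
  (-1) ^ (m + 1) / (m : ℂ) * z ^ m * ∑' j : ClosedChain m, chainProd K j

end NuclearDet

end

/-! ### Traces of powers and determinants in finite dimension. -/

section FiniteDimensional

open Polynomial

variable {V : Type*} [AddCommGroup V] [Module ℂ V] [FiniteDimensional ℂ V]

/-! Everything rests on `Det(I + A) = exp(∑ (-1)^(m+1)/m · tr A^m)` for nuclear `A` with `‖A‖ < 1`.
On a general Banach space the trace of a nuclear operator may depend on the decomposition; on `ℓᵖ`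
the canonical basis fixes it: by Fubini, `∑ₙ xₙ'(yₙ)` is the sum of the diagonal matrix entries
(`IsNuclearDecomposition.hasSum_diag`), so the trace is well defined and bounded by the nuclear
norm.

For finite rank the formula is the scalar logarithm series summed over the eigenvalues. To pass to
nuclear limits, telescoping gives `|tr A^(m+1) - tr F^(m+1)| ≤ (m+1) c^m ε` when `‖A‖, ‖F‖ ≤ c` and
`N(A - F) < ε`; the factor `1/(m+1)` cancels `m+1`, leaving a geometric series. As `‖·‖ ≤ N(·)`,
approximants of `A` eventually lie in such a ball, which yields `IsNuclear.hasNuclearDet_exp`.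

The hypothesis on `K` says that the columns have summable norms, so `T = ∑ⱼ eⱼ' ⊗ T eⱼ` is nuclear.
Since `|K(i,j)| ≤ ‖T eⱼ‖`, iterated matrix products converge absolutely, and `tr T^m` is the sum
over closed chains (`tsum_chainProd`). -/

theorem LinearMap.trace_pow_restrict_maxGenEigenspace (f : Module.End ℂ V) (μ : ℂ) (m : ℕ) :
    LinearMap.trace ℂ (f.maxGenEigenspace μ) ((f ^ m).restrict
      (Module.End.mapsTo_maxGenEigenspace_of_comm ((Commute.refl f).pow_right m) μ)) =
      μ ^ m * Module.finrank ℂ (f.maxGenEigenspace μ) := by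
  have hf := Module.End.mapsTo_maxGenEigenspace_of_comm (Commute.refl f) μ
  have key : (f ^ m).restrict
      (Module.End.mapsTo_maxGenEigenspace_of_comm ((Commute.refl f).pow_right m) μ) =
      (f.restrict hf) ^ m := (Module.End.pow_restrict m hf).symm
  have hnil : IsNilpotent (f.restrict hf - algebraMap ℂ _ μ) :=
    f.isNilpotent_restrict_maxGenEigenspace_sub_algebraMap μ
  rw [key]
  clear key
  induction m with
  | zero => simp
  | succ m ih =>
    -- Here `f - μ` is nilpotent and commutes with `f ^ m`, so it contributes nothing to the trace:
    -- each further factor `f` acts as `μ`.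
    rw [pow_succ (f.restrict hf), Module.End.mul_eq_comp,
      LinearMap.trace_comp_eq_mul_of_commute_of_isNilpotent μ
        ((Commute.refl (f.restrict hf)).pow_left m) hnil, ih]
    ring

theorem LinearMap.trace_pow_eq_sum_roots_charpoly (f : Module.End ℂ V) (m : ℕ) :
    LinearMap.trace ℂ V (f ^ m) = (f.charpoly.roots.map (· ^ m)).sum := by
  classical
  have hds := DirectSum.isInternal_submodule_of_iSupIndep_of_iSup_eq_top
    f.independent_maxGenEigenspace f.iSup_maxGenEigenspace_eq_top
  have hfin : {μ | f.maxGenEigenspace μ ≠ ⊥}.Finite :=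
    WellFoundedGT.finite_ne_bot_of_iSupIndep f.independent_maxGenEigenspace
  rw [LinearMap.trace_eq_sum_trace_restrict' hds hfin fun μ =>
    Module.End.mapsTo_maxGenEigenspace_of_comm ((Commute.refl f).pow_right m) μ]
  simp_rw [LinearMap.trace_pow_restrict_maxGenEigenspace]
  rw [Finset.sum_multiset_map_count]
  have hset : hfin.toFinset = f.charpoly.roots.toFinset := by
    ext μ
    rw [Set.Finite.mem_toFinset, Multiset.mem_toFinset, ← Multiset.count_pos, count_roots,
      ← LinearMap.finrank_maxGenEigenspace_eq, Set.mem_ofPred_eq, Module.finrank_pos_iff,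
      Submodule.nontrivial_iff_ne_bot]
  rw [hset]
  refine Finset.sum_congr rfl fun μ _ => ?_
  rw [LinearMap.finrank_maxGenEigenspace_eq, count_roots, nsmul_eq_mul, mul_comm]

theorem LinearMap.det_one_add_eq_prod_roots_charpoly (f : Module.End ℂ V) :
    LinearMap.det (1 + f) = (f.charpoly.roots.map (1 + ·)).prod := by
  have hs : f.charpoly.Splits := IsAlgClosed.splits _
  have h1 : f.charpoly.eval (-1) = (f.charpoly.roots.map fun a => -1 - a).prod := by
    conv_lhs => rw [hs.eq_prod_roots_of_monic f.charpoly_monic]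
    rw [eval_multiset_prod, Multiset.map_map]
    simp
  have hcard : f.charpoly.roots.card = Module.finrank ℂ V := by
    rw [← hs.natDegree_eq_card_roots, LinearMap.charpoly_natDegree]
  rw [LinearMap.eval_charpoly] at h1
  have h2 : algebraMap ℂ (Module.End ℂ V) (-1) - f = (-1 : ℂ) • (1 + f) := by
    rw [map_neg, map_one]; module
  have h3 : (fun a : ℂ => -1 - a) = fun a => (-1) * (1 + a) := by funext a; ring
  rw [h2, LinearMap.det_smul, h3, Multiset.prod_map_mul, Multiset.map_const', hcard,
    Multiset.prod_replicate] at h1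
  exact mul_left_cancel₀ (pow_ne_zero _ (by norm_num)) h1

/-- `S` is the sum of the principal logarithms of `1 + μ` over the eigenvalues with multiplicity.
Exponentiating removes any question of branches. -/
theorem LinearMap.exists_hasSum_trace_pow_exp_eq_det (f : Module.End ℂ V)
    (hf : ∀ μ, f.HasEigenvalue μ → ‖μ‖ < 1) :
    ∃ S : ℂ, HasSum (fun n : ℕ => (-1) ^ (n + 1 + 1) / ((n + 1 : ℕ) : ℂ) *
      LinearMap.trace ℂ V (f ^ (n + 1))) S ∧ Complex.exp S = LinearMap.det (1 + f) := by
  simp_rw [LinearMap.trace_pow_eq_sum_roots_charpoly, LinearMap.det_one_add_eq_prod_roots_charpoly]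
  have hr : ∀ μ ∈ f.charpoly.roots, ‖μ‖ < 1 := fun μ hμ =>
    hf μ ((Module.End.hasEigenvalue_iff_isRoot_charpoly f μ).2 (isRoot_of_mem_roots hμ))
  generalize f.charpoly.roots = s at hr
  induction s using Multiset.induction_on with
  | empty => exact ⟨0, by simp, by simp⟩
  | cons a s ih =>
    obtain ⟨S, hS, hexp⟩ := ih fun μ hμ => hr μ (Multiset.mem_cons_of_mem hμ)
    have ha : ‖a‖ < 1 := hr a (Multiset.mem_cons_self a s)
    -- The Taylor series is indexed from `0`, where division by zero makes the term vanish; the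
    -- shift drops it.
    have hlog := (hasSum_nat_add_iff' 1).2 (Complex.hasSum_taylorSeries_log ha)
    simp only [Finset.range_one, Finset.sum_singleton, Nat.cast_zero, div_zero, sub_zero] at hlog
    refine ⟨Complex.log (1 + a) + S, ?_, ?_⟩
    · refine (hlog.add hS).congr_fun ?_
      intro n
      rw [Multiset.map_cons, Multiset.sum_cons]
      ring
    · have h0 : 1 + a ≠ 0 := by
        intro h
        rw [← neg_eq_iff_add_eq_zero.2 (by linear_combination h : (1 : ℂ) + a = 0)] at ha
        simp at ha
      rw [Complex.exp_add, Complex.exp_log h0, hexp, Multiset.map_cons, Multiset.prod_cons]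

end FiniteDimensional

noncomputable section

namespace NuclearDet

/-! ### Nuclear and finite rank operators on a Banach space. -/

section Banach

variable {B : Type*} [NormedAddCommGroup B] [NormedSpace ℂ B]

theorem IsNuclearDecomposition.comp {T : B →L[ℂ] B} {x' : ℕ → (B →L[ℂ] ℂ)} {y : ℕ → B}
    (h : IsNuclearDecomposition T x' y) (E G : B →L[ℂ] B) :
    IsNuclearDecomposition (E ∘L T ∘L G) (fun n => x' n ∘L G) (fun n => E (y n)) where
  summable := by
    refine Summable.of_nonneg_of_le (fun n => by positivity) (fun n => ?_)
      (h.summable.mul_left (‖E‖ * ‖G‖))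
    calc ‖x' n ∘L G‖ * ‖E (y n)‖ ≤ (‖x' n‖ * ‖G‖) * (‖E‖ * ‖y n‖) :=
          mul_le_mul ((x' n).opNorm_comp_le G) (E.le_opNorm _) (norm_nonneg _) (by positivity)
      _ = ‖E‖ * ‖G‖ * (‖x' n‖ * ‖y n‖) := by ring
  hasSum x := by
    simpa [Function.comp_def] using (h.hasSum (G x)).map E E.continuous

theorem IsNuclearDecomposition.opNorm_le {T : B →L[ℂ] B} {x' : ℕ → (B →L[ℂ] ℂ)} {y : ℕ → B}
    (h : IsNuclearDecomposition T x' y) : ‖T‖ ≤ ∑' n, ‖x' n‖ * ‖y n‖ := by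
  refine T.opNorm_le_bound (tsum_nonneg fun n => by positivity) fun x => ?_
  rw [← tsum_mul_right]
  refine (h.hasSum x).tsum_eq ▸ tsum_of_norm_bounded (h.summable.mul_right ‖x‖).hasSum fun n => ?_
  rw [norm_smul, mul_right_comm]
  gcongr
  exact (x' n).le_opNorm x

theorem IsNuclear.comp {T : B →L[ℂ] B} (h : IsNuclear T) (E G : B →L[ℂ] B) :
    IsNuclear (E ∘L T ∘L G) :=
  let ⟨_, _, hd⟩ := h
  ⟨_, _, hd.comp E G⟩

theorem IsNuclear.smul {T : B →L[ℂ] B} (h : IsNuclear T) (z : ℂ) : IsNuclear (z • T) := by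
  simpa using h.comp (z • ContinuousLinearMap.id ℂ B) (ContinuousLinearMap.id ℂ B)

theorem exists_isNuclearDecomposition_of_nuclearNorm_lt {T : B →L[ℂ] B} {c : ℝ}
    (h : nuclearNorm T < ENNReal.ofReal c) :
    ∃ x' y, IsNuclearDecomposition T x' y ∧ ∑' n, ‖x' n‖ * ‖y n‖ < c := by
  simp only [nuclearNorm, iInf_lt_iff] at h
  obtain ⟨x', y, hd, hlt⟩ := h
  refine ⟨x', y, hd, (ENNReal.ofReal_lt_ofReal_iff_of_nonneg
    (tsum_nonneg fun n => by positivity)).1 ?_⟩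
  rw [ENNReal.ofReal_tsum_of_nonneg (fun n => by positivity) hd.summable]
  simpa only [ENNReal.ofReal_mul (norm_nonneg _), ofReal_norm] using hlt

/-- Lets decompositions be indexed by `ℤ` or `Fin d`: pad with zero functionals off the range of
`g`. -/
theorem exists_isNuclearDecomposition_of_injective {ι : Type*} {g : ι → ℕ}
    (hg : Function.Injective g) {T : B →L[ℂ] B} {x : ι → (B →L[ℂ] ℂ)} {y : ι → B}
    (hs : Summable fun i => ‖x i‖ * ‖y i‖) (hT : ∀ v, HasSum (fun i => x i v • y i) (T v)) :
    ∃ x' y', IsNuclearDecomposition T x' y' ∧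
      ∑' n, ‖x' n‖ * ‖y' n‖ = ∑' i, ‖x i‖ * ‖y i‖ := by
  have hx : ∀ n ∉ Set.range g, Function.extend g x 0 n = 0 := fun n hn =>
    Function.extend_apply' _ _ _ hn
  have hsum := (hg.hasSum_iff (f := fun n => ‖Function.extend g x 0 n‖ * ‖Function.extend g y 0 n‖)
    (a := ∑' i, ‖x i‖ * ‖y i‖) fun n hn => by simp [hx n hn]).1 (by
      simpa [Function.comp_def, hg.extend_apply] using hs.hasSum)
  refine ⟨Function.extend g x 0, Function.extend g y 0, ⟨hsum.summable, fun v => ?_⟩, hsum.tsum_eq⟩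
  refine (hg.hasSum_iff fun n hn => by simp [hx n hn]).1 ?_
  simpa [Function.comp_def, hg.extend_apply] using hT v

theorem isFiniteRank_sum_smulRight (x' : ℕ → (B →L[ℂ] ℂ)) (y : ℕ → B) (n : ℕ) :
    IsFiniteRank (∑ k ∈ Finset.range n, (x' k).smulRight (y k)) := by
  have hle : LinearMap.range ((∑ k ∈ Finset.range n, (x' k).smulRight (y k) : B →L[ℂ] B) :
      B →ₗ[ℂ] B) ≤ Submodule.span ℂ (y '' Finset.range n) := by
    rintro _ ⟨v, rfl⟩
    rw [ContinuousLinearMap.coe_coe, sum_apply]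
    exact Submodule.sum_mem _ fun k hk => Submodule.smul_mem _ _
      (Submodule.subset_span (Set.mem_image_of_mem y hk))
  have := FiniteDimensional.span_of_finite ℂ ((Finset.range n).finite_toSet.image y)
  exact Submodule.finiteDimensional_of_le hle

/-- Truncate a decomposition; its tail decomposes the error. -/
theorem IsNuclear.exists_approximates {T : B →L[ℂ] B} (h : IsNuclear T) :
    ∃ F : ℕ → (B →L[ℂ] B), Approximates F T := by
  obtain ⟨x', y, hd⟩ := h
  refine ⟨fun n => ∑ k ∈ Finset.range n, (x' k).smulRight (y k),
    isFiniteRank_sum_smulRight x' y, ?_⟩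
  have htop : ∑' n, ‖x' n‖ₑ * ‖y n‖ₑ ≠ ∞ := by
    simpa only [ENNReal.ofReal_mul (norm_nonneg _), ofReal_norm] using hd.summable.tsum_ofReal_ne_top
  refine tendsto_of_tendsto_of_tendsto_of_le_of_le tendsto_const_nhds
    (ENNReal.tendsto_sum_nat_add _ htop) (fun _ => zero_le) fun n => ?_
  have hdn : IsNuclearDecomposition (T - ∑ k ∈ Finset.range n, (x' k).smulRight (y k))
      (fun k => x' (k + n)) (fun k => y (k + n)) := by
    refine ⟨(summable_nat_add_iff n).2 hd.summable, fun v => ?_⟩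
    simpa using (hasSum_nat_add_iff' n).2 (hd.hasSum v)
  exact iInf_le_of_le _ (iInf_le_of_le _ (iInf_le_of_le hdn le_rfl))

theorem IsFiniteRank.exists_basis_coord {F : B →L[ℂ] B} (hF : IsFiniteRank F) :
    ∃ (d : ℕ) (b : Module.Basis (Fin d) ℂ (LinearMap.range (F : B →ₗ[ℂ] B)))
      (φ : Fin d → (B →L[ℂ] ℂ)), ∀ v k, φ k v = b.repr ⟨F v, LinearMap.mem_range_self _ v⟩ k := by
  have : FiniteDimensional ℂ (LinearMap.range (F : B →ₗ[ℂ] B)) := hF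
  let b := Module.finBasis ℂ (LinearMap.range (F : B →ₗ[ℂ] B))
  let R : B →L[ℂ] LinearMap.range (F : B →ₗ[ℂ] B) :=
    F.codRestrict _ fun v => LinearMap.mem_range_self _ v
  exact ⟨_, b, fun k => (LinearMap.toContinuousLinearMap (b.coord k)) ∘L R, fun v k => rfl⟩

theorem IsFiniteRank.isNuclear {F : B →L[ℂ] B} (hF : IsFiniteRank F) : IsNuclear F := by
  obtain ⟨d, b, φ, hφ⟩ := hF.exists_basis_coord
  obtain ⟨x', y, h, -⟩ := exists_isNuclearDecomposition_of_injective (T := F)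
    (Fin.val_injective (n := d)) (x := φ) (y := fun k => (b k : B)) (Summable.of_finite) fun v => by
      have := congrArg Subtype.val (b.sum_repr ⟨F v, LinearMap.mem_range_self _ v⟩)
      simp only [Submodule.coe_sum, Submodule.coe_smul] at this
      rw [← this]
      simp_rw [hφ]
      exact hasSum_fintype _
  exact ⟨x', y, h⟩

end Banach

/-! ### The trace of nuclear operators on `ℓᵖ(ℤ)`. -/

section Trace

variable {p : ℝ≥0∞} [Fact (1 ≤ p)]

theorem lp_toReal_pos (hp : p ≠ ∞) : 0 < p.toReal :=
  ENNReal.toReal_pos (zero_lt_one.trans_le Fact.out).ne' hp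

theorem hasSum_smul_single (hp : p ≠ ∞) (y : lp (fun _ : ℤ => ℂ) p) :
    HasSum (fun i => y i • lp.single (E := fun _ : ℤ => ℂ) p i (1 : ℂ)) y := by
  refine (lp.hasSum_single hp y).congr_fun fun i => ?_
  rw [← lp.single_smul, smul_eq_mul, mul_one]

theorem hasSum_apply_single_mul (hp : p ≠ ∞) (φ : lp (fun _ : ℤ => ℂ) p →L[ℂ] ℂ)
    (y : lp (fun _ : ℤ => ℂ) p) :
    HasSum (fun i => φ (lp.single p i (1 : ℂ)) * y i) (φ y) := by
  refine ((hasSum_smul_single hp y).map φ φ.continuous).congr_fun fun i => ?_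
  simp [mul_comm]

/-- Rotate each term to its absolute value by a unimodular `θ i`. Truncating `y` and changing the
phases of its coordinates does not increase its `ℓᵖ` norm. -/
theorem sum_norm_apply_single_mul_le (hp : p ≠ ∞) (φ : lp (fun _ : ℤ => ℂ) p →L[ℂ] ℂ)
    (y : lp (fun _ : ℤ => ℂ) p) (s : Finset ℤ) :
    ∑ i ∈ s, ‖φ (lp.single p i (1 : ℂ)) * y i‖ ≤ ‖φ‖ * ‖y‖ := by
  have hp' := lp_toReal_pos hp
  choose θ hθ h using fun i => RCLike.exists_norm_eq_mul_self (φ (lp.single p i (1 : ℂ)) * y i)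
  have hy : ‖∑ i ∈ s, lp.single (E := fun _ : ℤ => ℂ) p i (θ i * y i)‖ ≤ ‖y‖ := by
    rw [← Real.rpow_le_rpow_iff (norm_nonneg _) (norm_nonneg _) hp',
      lp.norm_sum_single (E := fun _ : ℤ => ℂ) hp' (fun i => θ i * y i) s]
    simp_rw [norm_mul, hθ, one_mul]
    exact lp.sum_rpow_le_norm_rpow hp' y s
  have hsum : ((∑ i ∈ s, ‖φ (lp.single p i (1 : ℂ)) * y i‖ : ℝ) : ℂ) =
      φ (∑ i ∈ s, lp.single (E := fun _ : ℤ => ℂ) p i (θ i * y i)) := by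
    rw [map_sum]
    push_cast
    refine Finset.sum_congr rfl fun i _ => ?_
    have hi : lp.single (E := fun _ : ℤ => ℂ) p i (θ i * y i) =
        (θ i * y i) • lp.single (E := fun _ : ℤ => ℂ) p i (1 : ℂ) := by
      rw [← lp.single_smul, smul_eq_mul, mul_one]
    rw [hi, map_smul, smul_eq_mul]
    exact (h i).trans (by ring)
  calc ∑ i ∈ s, ‖φ (lp.single p i (1 : ℂ)) * y i‖
      = ‖((∑ i ∈ s, ‖φ (lp.single p i (1 : ℂ)) * y i‖ : ℝ) : ℂ)‖ := by
        rw [Complex.norm_real, Real.norm_of_nonneg (Finset.sum_nonneg fun _ _ => norm_nonneg _)]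
    _ ≤ ‖φ‖ * ‖∑ i ∈ s, lp.single (E := fun _ : ℤ => ℂ) p i (θ i * y i)‖ := by
        rw [hsum]; exact φ.le_opNorm _
    _ ≤ ‖φ‖ * ‖y‖ := by gcongr

/-- Fubini for `x'ₙ(eᵢ) yₙ(i)` on `ℕ × ℤ`. The left side does not involve the decomposition, so
neither does the trace. -/
theorem IsNuclearDecomposition.hasSum_diag (hp : p ≠ ∞)
    {T : lp (fun _ : ℤ => ℂ) p →L[ℂ] lp (fun _ : ℤ => ℂ) p}
    {x' : ℕ → (lp (fun _ : ℤ => ℂ) p →L[ℂ] ℂ)} {y : ℕ → lp (fun _ : ℤ => ℂ) p}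
    (h : IsNuclearDecomposition T x' y) :
    HasSum (fun i => T (lp.single p i (1 : ℂ)) i) (∑' n, x' n (y n)) := by
  have hs : Summable fun q : ℕ × ℤ => x' q.1 (lp.single p q.2 (1 : ℂ)) * y q.1 q.2 := by
    refine Summable.of_norm ((summable_prod_of_nonneg fun _ => norm_nonneg _).2 ⟨fun n => ?_, ?_⟩)
    · exact summable_of_sum_le (fun _ => norm_nonneg _) (sum_norm_apply_single_mul_le hp (x' n) (y n))
    · exact Summable.of_nonneg_of_le (fun n => tsum_nonneg fun _ => norm_nonneg _)
        (fun n => Real.tsum_le_of_sum_le (fun _ => norm_nonneg _)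
          (sum_norm_apply_single_mul_le hp (x' n) (y n))) h.summable
  have h1 : ∑' q : ℕ × ℤ, x' q.1 (lp.single p q.2 (1 : ℂ)) * y q.1 q.2 = ∑' n, x' n (y n) :=
    (hs.hasSum.prod_fiberwise fun n => hasSum_apply_single_mul hp (x' n) (y n)).tsum_eq.symm
  rw [← h1]
  refine ((Equiv.prodComm ℤ ℕ).hasSum_iff.2 hs.hasSum).prod_fiberwise fun i => ?_
  exact (h.hasSum (lp.single p i (1 : ℂ))).map
    (lp.evalCLM ℂ (fun _ : ℤ => ℂ) p i) (lp.evalCLM ℂ (fun _ : ℤ => ℂ) p i).continuous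

/-- The trace `∑ᵢ (A eᵢ)(i)` of an operator on `ℓᵖ(ℤ)`. -/
def diagTrace (A : lp (fun _ : ℤ => ℂ) p →L[ℂ] lp (fun _ : ℤ => ℂ) p) : ℂ :=
  ∑' i, A (lp.single p i (1 : ℂ)) i

theorem IsNuclear.summable_diag (hp : p ≠ ∞)
    {T : lp (fun _ : ℤ => ℂ) p →L[ℂ] lp (fun _ : ℤ => ℂ) p} (h : IsNuclear T) :
    Summable fun i => T (lp.single p i (1 : ℂ)) i :=
  let ⟨_, _, hd⟩ := h
  (hd.hasSum_diag hp).summable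

theorem IsNuclearDecomposition.norm_diagTrace_le (hp : p ≠ ∞)
    {T : lp (fun _ : ℤ => ℂ) p →L[ℂ] lp (fun _ : ℤ => ℂ) p}
    {x' : ℕ → (lp (fun _ : ℤ => ℂ) p →L[ℂ] ℂ)} {y : ℕ → lp (fun _ : ℤ => ℂ) p}
    (h : IsNuclearDecomposition T x' y) : ‖diagTrace T‖ ≤ ∑' n, ‖x' n‖ * ‖y n‖ := by
  rw [diagTrace, (h.hasSum_diag hp).tsum_eq]
  exact tsum_of_norm_bounded h.summable.hasSum fun n => (x' n).le_opNorm (y n)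

theorem IsNuclearDecomposition.norm_diagTrace_comp_le (hp : p ≠ ∞)
    {T : lp (fun _ : ℤ => ℂ) p →L[ℂ] lp (fun _ : ℤ => ℂ) p}
    {x' : ℕ → (lp (fun _ : ℤ => ℂ) p →L[ℂ] ℂ)} {y : ℕ → lp (fun _ : ℤ => ℂ) p}
    (h : IsNuclearDecomposition T x' y) (E G : lp (fun _ : ℤ => ℂ) p →L[ℂ] lp (fun _ : ℤ => ℂ) p) :
    ‖diagTrace (E ∘L T ∘L G)‖ ≤ ‖E‖ * ‖G‖ * ∑' n, ‖x' n‖ * ‖y n‖ := by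
  refine ((h.comp E G).norm_diagTrace_le hp).trans ?_
  rw [← tsum_mul_left]
  refine (h.comp E G).summable.tsum_le_tsum (fun n => ?_) (h.summable.mul_left _)
  calc ‖x' n ∘L G‖ * ‖E (y n)‖ ≤ (‖x' n‖ * ‖G‖) * (‖E‖ * ‖y n‖) :=
        mul_le_mul ((x' n).opNorm_comp_le G) (E.le_opNorm _) (norm_nonneg _) (by positivity)
    _ = ‖E‖ * ‖G‖ * (‖x' n‖ * ‖y n‖) := by ring

/-- Telescoping: `A^(m+2) - F^(m+2) = A (A^(m+1) - F^(m+1)) + (A - F) F^(m+1)`. The free left factor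
`E` absorbs `A` in the induction. -/
theorem norm_diagTrace_mul_pow_sub_pow_le (hp : p ≠ ∞)
    {A F : lp (fun _ : ℤ => ℂ) p →L[ℂ] lp (fun _ : ℤ => ℂ) p} {c ε : ℝ}
    (hAc : ‖A‖ ≤ c) (hFc : ‖F‖ ≤ c) (hε : nuclearNorm (A - F) < ENNReal.ofReal ε)
    (m : ℕ) (E : lp (fun _ : ℤ => ℂ) p →L[ℂ] lp (fun _ : ℤ => ℂ) p) :
    (Summable fun i => (E * (A ^ (m + 1) - F ^ (m + 1))) (lp.single p i (1 : ℂ)) i) ∧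
      ‖diagTrace (E * (A ^ (m + 1) - F ^ (m + 1)))‖ ≤ ‖E‖ * ((m + 1) * c ^ m * ε) := by
  have hc : 0 ≤ c := (norm_nonneg _).trans hAc
  obtain ⟨x', y, hd, hlt⟩ := exists_isNuclearDecomposition_of_nuclearNorm_lt hε
  induction m generalizing E with
  | zero =>
    have h := hd.comp E 1
    have he : E ∘L (A - F) ∘L 1 = E * (A ^ (0 + 1) - F ^ (0 + 1)) := by
      rw [pow_one, pow_one]; rfl
    rw [← he]
    refine ⟨(h.hasSum_diag hp).summable, (hd.norm_diagTrace_comp_le hp E 1).trans ?_⟩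
    have h1 : ‖(1 : lp (fun _ : ℤ => ℂ) p →L[ℂ] lp (fun _ : ℤ => ℂ) p)‖ ≤ 1 :=
      ContinuousLinearMap.norm_id_le
    have h0 : 0 ≤ ∑' n, ‖x' n‖ * ‖y n‖ := tsum_nonneg fun n => by positivity
    calc ‖E‖ * ‖(1 : lp (fun _ : ℤ => ℂ) p →L[ℂ] lp (fun _ : ℤ => ℂ) p)‖ * ∑' n, ‖x' n‖ * ‖y n‖
        ≤ ‖E‖ * 1 * ε := by gcongr
      _ = _ := by simp
  | succ m ih =>
    obtain ⟨ihs, ihle⟩ := ih (E * A)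
    have h := hd.comp E (F ^ (m + 1))
    have hsum := (h.hasSum_diag hp).summable
    have he : E * (A ^ (m + 1 + 1) - F ^ (m + 1 + 1)) =
        E * A * (A ^ (m + 1) - F ^ (m + 1)) + E ∘L (A - F) ∘L F ^ (m + 1) := by
      change _ = _ + E * ((A - F) * F ^ (m + 1))
      rw [pow_succ' A (m + 1), pow_succ' F (m + 1)]
      noncomm_ring
    have ht : diagTrace (E * (A ^ (m + 1 + 1) - F ^ (m + 1 + 1))) =
        diagTrace (E * A * (A ^ (m + 1) - F ^ (m + 1))) +
          diagTrace (E ∘L (A - F) ∘L F ^ (m + 1)) := by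
      rw [he, diagTrace, diagTrace, diagTrace, ← ihs.tsum_add hsum]
      rfl
    refine ⟨by rw [he]; exact ihs.add hsum, ?_⟩
    rw [ht]
    have h0 : 0 ≤ ∑' n, ‖x' n‖ * ‖y n‖ := tsum_nonneg fun n => by positivity
    have hε0 : 0 ≤ ε := h0.trans hlt.le
    have hpow : ‖F ^ (m + 1)‖ ≤ c ^ (m + 1) :=
      (norm_pow_le' F m.succ_pos).trans (pow_le_pow_left₀ (norm_nonneg _) hFc _)
    calc _ ≤ ‖E * A‖ * ((m + 1) * c ^ m * ε) + ‖E‖ * ‖F ^ (m + 1)‖ * ∑' n, ‖x' n‖ * ‖y n‖ :=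
          (norm_add_le _ _).trans (add_le_add ihle (hd.norm_diagTrace_comp_le hp _ _))
      _ ≤ (‖E‖ * c) * ((m + 1) * c ^ m * ε) + ‖E‖ * c ^ (m + 1) * ε := by
          gcongr
          exact (norm_mul_le _ _).trans (by gcongr)
      _ = _ := by push_cast; ring

end Trace

/-! ### The logarithm series and its continuity in the nuclear norm. -/

section Determinant

variable {p : ℝ≥0∞} [Fact (1 ≤ p)]

theorem IsNuclear.pow {B : Type*} [NormedAddCommGroup B] [NormedSpace ℂ B] {A : B →L[ℂ] B}
    (hA : IsNuclear A) (m : ℕ) : IsNuclear (A ^ (m + 1)) := by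
  have h := hA.comp (A ^ m) 1
  rwa [show (A ^ m) ∘L A ∘L 1 = A ^ (m + 1) from (pow_succ A m).symm] at h

/-- The term `((-1)^(m+2) / (m+1)) tr A^(m+1)` of the logarithm of `Det(I + A)`. -/
def logDetTerm (A : lp (fun _ : ℤ => ℂ) p →L[ℂ] lp (fun _ : ℤ => ℂ) p) (m : ℕ) : ℂ :=
  (-1) ^ (m + 1 + 1) / ((m + 1 : ℕ) : ℂ) * diagTrace (A ^ (m + 1))

theorem norm_logDetTerm_coeff (m : ℕ) :
    ‖(-1 : ℂ) ^ (m + 1 + 1) / ((m + 1 : ℕ) : ℂ)‖ = ((m : ℝ) + 1)⁻¹ := by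
  rw [norm_div, norm_pow, norm_neg, norm_one, one_pow, Complex.norm_natCast, one_div]
  push_cast
  rfl

theorem IsNuclear.summable_logDetTerm (hp : p ≠ ∞)
    {A : lp (fun _ : ℤ => ℂ) p →L[ℂ] lp (fun _ : ℤ => ℂ) p} (hA : IsNuclear A) (h1 : ‖A‖ < 1) :
    Summable (logDetTerm A) := by
  obtain ⟨x', y, hd⟩ := hA
  have h0 : 0 ≤ ∑' n, ‖x' n‖ * ‖y n‖ := tsum_nonneg fun n => by positivity
  have hone : ‖(1 : lp (fun _ : ℤ => ℂ) p →L[ℂ] lp (fun _ : ℤ => ℂ) p)‖ ≤ 1 :=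
    ContinuousLinearMap.norm_id_le
  refine Summable.of_norm_bounded ((summable_geometric_of_lt_one (norm_nonneg A) h1).mul_right
    (∑' n, ‖x' n‖ * ‖y n‖)) fun m => ?_
  have ht := hd.norm_diagTrace_comp_le hp (A ^ m) 1
  rw [show (A ^ m) ∘L A ∘L 1 = A ^ (m + 1) from (pow_succ A m).symm] at ht
  have hpow : ‖A ^ m‖ ≤ ‖A‖ ^ m := by
    rcases m.eq_zero_or_pos with rfl | hm
    · simpa using hone
    · exact norm_pow_le' A hm
  rw [logDetTerm, norm_mul, norm_logDetTerm_coeff]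
  calc _ ≤ 1 * ‖diagTrace (A ^ (m + 1))‖ := by
        gcongr
        exact inv_le_one_of_one_le₀ (by linarith [(Nat.cast_nonneg m : (0 : ℝ) ≤ m)])
    _ ≤ ‖A ^ m‖ * ‖(1 : lp (fun _ : ℤ => ℂ) p →L[ℂ] lp (fun _ : ℤ => ℂ) p)‖ *
        ∑' n, ‖x' n‖ * ‖y n‖ := by rw [one_mul]; exact ht
    _ ≤ ‖A‖ ^ m * 1 * ∑' n, ‖x' n‖ * ‖y n‖ := by gcongr
    _ = _ := by rw [mul_one]

theorem norm_tsum_logDetTerm_sub_le (hp : p ≠ ∞)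
    {A F : lp (fun _ : ℤ => ℂ) p →L[ℂ] lp (fun _ : ℤ => ℂ) p} (hA : IsNuclear A) (hF : IsNuclear F)
    {c ε : ℝ} (hc1 : c < 1) (hAc : ‖A‖ ≤ c) (hFc : ‖F‖ ≤ c)
    (hε : nuclearNorm (A - F) < ENNReal.ofReal ε) :
    ‖∑' m, logDetTerm A m - ∑' m, logDetTerm F m‖ ≤ ε * (1 - c)⁻¹ := by
  have hc : 0 ≤ c := (norm_nonneg _).trans hAc
  have hε0 : 0 < ε := ENNReal.ofReal_pos.1 (zero_le.trans_lt hε)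
  rw [← (hA.summable_logDetTerm hp (hAc.trans_lt hc1)).tsum_sub
    (hF.summable_logDetTerm hp (hFc.trans_lt hc1))]
  refine tsum_of_norm_bounded ((hasSum_geometric_of_lt_one hc hc1).mul_left ε) fun m => ?_
  have hd : diagTrace (1 * (A ^ (m + 1) - F ^ (m + 1))) =
      diagTrace (A ^ (m + 1)) - diagTrace (F ^ (m + 1)) := by
    rw [one_mul, diagTrace, diagTrace, diagTrace,
      ← ((hA.pow m).summable_diag hp).tsum_sub ((hF.pow m).summable_diag hp)]
    rfl
  have hle := (norm_diagTrace_mul_pow_sub_pow_le hp hAc hFc hε m 1).2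
  have hone : ‖(1 : lp (fun _ : ℤ => ℂ) p →L[ℂ] lp (fun _ : ℤ => ℂ) p)‖ ≤ 1 :=
    ContinuousLinearMap.norm_id_le
  rw [logDetTerm, logDetTerm, ← mul_sub, ← hd, norm_mul, norm_logDetTerm_coeff]
  have hm : (0 : ℝ) < m + 1 := by positivity
  calc _ ≤ ((m : ℝ) + 1)⁻¹ * (1 * ((m + 1) * c ^ m * ε)) := by
        gcongr
        exact hle.trans (by gcongr)
    _ = ε * c ^ m := by field_simp

/-- With a basis `b` of the range and its coordinate functionals `φ k` of `F v`, both sides equal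
`∑ₖ φₖ(F^m bₖ)`. -/
theorem IsFiniteRank.diagTrace_pow_succ (hp : p ≠ ∞)
    {F : lp (fun _ : ℤ => ℂ) p →L[ℂ] lp (fun _ : ℤ => ℂ) p} (hF : IsFiniteRank F) (m : ℕ) :
    diagTrace (F ^ (m + 1)) = LinearMap.trace ℂ _ (((F : lp (fun _ : ℤ => ℂ) p →ₗ[ℂ] _).restrict
      (p := LinearMap.range (F : lp (fun _ : ℤ => ℂ) p →ₗ[ℂ] lp (fun _ : ℤ => ℂ) p))
      (q := LinearMap.range (F : lp (fun _ : ℤ => ℂ) p →ₗ[ℂ] lp (fun _ : ℤ => ℂ) p))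
      (fun x _ => LinearMap.mem_range_self _ x)) ^ (m + 1)) := by
  obtain ⟨d, b, φ, hφ⟩ := hF.exists_basis_coord
  set f := (F : lp (fun _ : ℤ => ℂ) p →ₗ[ℂ] _).restrict
      (p := LinearMap.range (F : lp (fun _ : ℤ => ℂ) p →ₗ[ℂ] lp (fun _ : ℤ => ℂ) p))
      (q := LinearMap.range (F : lp (fun _ : ℤ => ℂ) p →ₗ[ℂ] lp (fun _ : ℤ => ℂ) p))
      (fun x _ => LinearMap.mem_range_self _ x) with hf
  have hFv : ∀ v, F v = ∑ k, φ k v • (b k : lp (fun _ : ℤ => ℂ) p) := fun v => by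
    have := congrArg Subtype.val (b.sum_repr ⟨F v, LinearMap.mem_range_self _ v⟩)
    simp only [Submodule.coe_sum, Submodule.coe_smul] at this
    simp_rw [hφ]
    exact this.symm
  have hpow : ∀ (n : ℕ) v, ((f ^ n) v : lp (fun _ : ℤ => ℂ) p) = (F ^ n) v := fun n v => by
    induction n with
    | zero => rfl
    | succ n ih =>
      rw [pow_succ', pow_succ' F, Module.End.mul_apply,
        mul_apply_eq_comp, ← ih]
      rfl
  have hleft : HasSum (fun i => (F ^ (m + 1)) (lp.single p i (1 : ℂ)) i)
      (∑ k, φ k ((F ^ m) (b k))) := by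
    refine (hasSum_sum (s := Finset.univ) fun k _ =>
      hasSum_apply_single_mul hp (φ k) ((F ^ m) (b k))).congr_fun fun i => ?_
    rw [pow_succ, mul_apply_eq_comp, hFv, map_sum, lp.coeFn_sum,
      Finset.sum_apply]
    simp
  rw [diagTrace, hleft.tsum_eq, LinearMap.trace_eq_matrix_trace ℂ b, Matrix.trace]
  refine Finset.sum_congr rfl fun k _ => ?_
  rw [Matrix.diag_apply, LinearMap.toMatrix_apply, hφ, pow_succ', Module.End.mul_apply]
  congr 2
  ext1
  rw [← hpow]
  rfl

theorem IsFiniteRank.exp_tsum_logDetTerm (hp : p ≠ ∞)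
    {F : lp (fun _ : ℤ => ℂ) p →L[ℂ] lp (fun _ : ℤ => ℂ) p} (hF : IsFiniteRank F) (h1 : ‖F‖ < 1) :
    Complex.exp (∑' m, logDetTerm F m) = finiteRankDet F := by
  have : FiniteDimensional ℂ
      (LinearMap.range (F : lp (fun _ : ℤ => ℂ) p →ₗ[ℂ] lp (fun _ : ℤ => ℂ) p)) := hF
  obtain ⟨S, hS, hexp⟩ := LinearMap.exists_hasSum_trace_pow_exp_eq_det
    ((F : lp (fun _ : ℤ => ℂ) p →ₗ[ℂ] _).restrict
      (p := LinearMap.range (F : lp (fun _ : ℤ => ℂ) p →ₗ[ℂ] lp (fun _ : ℤ => ℂ) p))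
      (q := LinearMap.range (F : lp (fun _ : ℤ => ℂ) p →ₗ[ℂ] lp (fun _ : ℤ => ℂ) p))
      (fun x _ => LinearMap.mem_range_self _ x)) fun μ hμ => by
    -- Eigenvalues on the range are bounded by `‖F‖`.
    obtain ⟨v, hv⟩ := hμ.exists_hasEigenvector
    have hFv : F v = μ • (v : lp (fun _ : ℤ => ℂ) p) := congrArg Subtype.val hv.apply_eq_smul
    have hv0 : 0 < ‖(v : lp (fun _ : ℤ => ℂ) p)‖ :=
      norm_pos_iff.2 fun h => hv.2 (Subtype.ext h)
    have hle := F.le_opNorm v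
    rw [hFv, norm_smul] at hle
    exact (le_of_mul_le_mul_right hle hv0).trans_lt h1
  rw [finiteRankDet, ← hexp, ← hS.tsum_eq]
  simp_rw [logDetTerm, hF.diagTrace_pow_succ hp]

theorem IsNuclear.hasNuclearDet_exp (hp : p ≠ ∞)
    {A : lp (fun _ : ℤ => ℂ) p →L[ℂ] lp (fun _ : ℤ => ℂ) p} (hA : IsNuclear A) (h1 : ‖A‖ < 1) :
    HasNuclearDet A (Complex.exp (∑' m, logDetTerm A m)) := by
  refine ⟨hA.exists_approximates, fun F hF => ?_⟩
  -- The midpoint of `‖A‖` and `1`: anything within `(1 - ‖A‖) / 2` of `A` has norm at most `c < 1`.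
  set c := (1 + ‖A‖) / 2 with hc
  have hclose : ∀ ε : ℝ, 0 < ε → ∀ᶠ n in atTop, nuclearNorm (A - F n) < ENNReal.ofReal ε :=
    fun ε hε => hF.2.eventually_lt_const (ENNReal.ofReal_pos.2 hε)
  have hFc : ∀ᶠ n in atTop, ‖F n‖ ≤ c := by
    filter_upwards [hclose ((1 - ‖A‖) / 2) (by linarith)] with n hn
    obtain ⟨x', y, hd, hlt⟩ := exists_isNuclearDecomposition_of_nuclearNorm_lt hn
    have := norm_sub_norm_le (F n) A
    rw [norm_sub_rev] at this
    linarith [hd.opNorm_le]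
  have hc1 : c < 1 := by rw [hc]; linarith
  have hlim : Tendsto (fun n => ∑' m, logDetTerm (F n) m) atTop (𝓝 (∑' m, logDetTerm A m)) := by
    rw [Metric.tendsto_nhds]
    intro δ hδ
    -- Chosen so that `ε (1 - c)⁻¹ = δ / 2`.
    have hε : 0 < δ * (1 - c) / 2 := by
      have : 0 < 1 - c := by linarith
      positivity
    filter_upwards [hFc, hclose _ hε] with n hn hn'
    rw [dist_comm, dist_eq_norm]
    refine (norm_tsum_logDetTerm_sub_le hp hA (hF.1 n).isNuclear hc1 (by rw [hc]; linarith) hn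
      hn').trans_lt ?_
    have : 1 - c ≠ 0 := by linarith
    field_simp
    linarith
  refine ((Complex.continuous_exp.tendsto _).comp hlim).congr' ?_
  filter_upwards [hFc] with n hn
  exact (hF.1 n).exp_tsum_logDetTerm hp (hn.trans_lt hc1)

end Determinant

/-! ### Operators with a given kernel, and their nuclearity. -/

section Kernel

variable {p : ℝ≥0∞} [Fact (1 ≤ p)]

theorem enorm_lp_eq (hp : p ≠ ∞) (y : lp (fun _ : ℤ => ℂ) p) :
    ‖y‖ₑ = (∑' m, ‖y m‖ₑ ^ p.toReal) ^ (1 / p.toReal) := by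
  have hp' := lp_toReal_pos hp
  have hs := (lp.hasSum_norm hp' y).summable
  rw [← ofReal_norm, lp.norm_eq_tsum_rpow hp', ← ENNReal.ofReal_rpow_of_nonneg
    (tsum_nonneg fun _ => by positivity) (by positivity),
    ENNReal.ofReal_tsum_of_nonneg (fun _ => by positivity) hs]
  simp_rw [← ENNReal.ofReal_rpow_of_nonneg (norm_nonneg _) hp'.le, ofReal_norm]

theorem memℓp_of_tsum_enorm_ne_top (hp : p ≠ ∞) {f : ℤ → ℂ}
    (hf : (∑' m, ‖f m‖ₑ ^ p.toReal) ^ (1 / p.toReal) ≠ ∞) : Memℓp f p := by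
  have hp' := lp_toReal_pos hp
  have h : ∑' m, ‖f m‖ₑ ^ p.toReal ≠ ∞ := fun h => hf (by
    rw [h, ENNReal.top_rpow_of_pos (by positivity)])
  refine memℓp_gen ?_
  have := ENNReal.summable_toReal h
  simpa [← ENNReal.toReal_rpow] using this

theorem HasKernel.ext (hp : p ≠ ∞) {K : ℤ → ℤ → ℂ}
    {T U : lp (fun _ : ℤ => ℂ) p →L[ℂ] lp (fun _ : ℤ => ℂ) p} (hT : HasKernel T K)
    (hU : HasKernel U K) : T = U := by
  refine lp.ext_continuousLinearMap hp fun j => ?_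
  ext i
  simpa using (hT i j).trans (hU i j).symm

theorem norm_evalCLM_le (j : ℤ) : ‖lp.evalCLM ℂ (fun _ : ℤ => ℂ) p j‖ ≤ 1 :=
  ContinuousLinearMap.opNorm_le_bound _ zero_le_one fun y => by
    rw [one_mul]
    exact lp.norm_apply_le_norm (zero_lt_one.trans_le Fact.out).ne' y j

/-- The series `∑ⱼ eⱼ' ⊗ yⱼ` converges absolutely in operator norm because `‖eⱼ'‖ ≤ 1`. -/
theorem exists_apply_single_eq {y : ℤ → lp (fun _ : ℤ => ℂ) p} (hy : Summable fun j => ‖y j‖) :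
    ∃ T : lp (fun _ : ℤ => ℂ) p →L[ℂ] lp (fun _ : ℤ => ℂ) p,
      ∀ j, T (lp.single p j (1 : ℂ)) = y j := by
  have hs : Summable fun j => (lp.evalCLM ℂ (fun _ : ℤ => ℂ) p j).smulRight (y j) := by
    refine Summable.of_norm_bounded hy fun j => ?_
    rw [ContinuousLinearMap.norm_smulRight_apply]
    exact mul_le_of_le_one_left (norm_nonneg _) (norm_evalCLM_le j)
  refine ⟨_, fun j => ((hs.hasSum.map
    (ContinuousLinearMap.apply ℂ (lp (fun _ : ℤ => ℂ) p) (lp.single p j (1 : ℂ)))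
    (ContinuousLinearMap.continuous _)).unique ?_)⟩
  have hval : ∀ k, (lp.evalCLM ℂ (fun _ : ℤ => ℂ) p k).smulRight (y k) (lp.single p j (1 : ℂ)) =
      if k = j then y j else 0 := fun k => by
    change (lp.single (E := fun _ : ℤ => ℂ) p j (1 : ℂ)) k • y k = _
    split_ifs with h
    · subst h
      rw [lp.single_apply_self, one_smul]
    · rw [lp.single_apply_ne _ _ _ h, zero_smul]
  exact (hasSum_ite_eq j (y j)).congr_fun hval

theorem isNuclear_of_summable_norm_apply_single (hp : p ≠ ∞)
    {T : lp (fun _ : ℤ => ℂ) p →L[ℂ] lp (fun _ : ℤ => ℂ) p}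
    (hT : Summable fun j => ‖T (lp.single p j (1 : ℂ))‖) : IsNuclear T := by
  obtain ⟨x', y, h, -⟩ := exists_isNuclearDecomposition_of_injective (T := T)
    (Encodable.encode_injective (α := ℤ)) (x := fun j => lp.evalCLM ℂ (fun _ : ℤ => ℂ) p j)
    (y := fun j => T (lp.single p j (1 : ℂ)))
    (Summable.of_nonneg_of_le (fun j => by positivity)
      (fun j => mul_le_of_le_one_left (norm_nonneg _) (norm_evalCLM_le j)) hT) fun v => by
      refine ((hasSum_smul_single hp v).map T T.continuous).congr_fun fun j => ?_
      rw [Function.comp_apply, map_smul]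
      rfl
  exact ⟨x', y, h⟩

theorem HasKernel.summable_norm_apply_single (hp : p ≠ ∞) {K : ℤ → ℤ → ℂ}
    {T : lp (fun _ : ℤ => ℂ) p →L[ℂ] lp (fun _ : ℤ => ℂ) p} (hT : HasKernel T K)
    (hK : ∑' j : ℤ, (∑' m : ℤ, ‖K m j‖ₑ ^ p.toReal) ^ (1 / p.toReal) < ∞) :
    Summable fun j => ‖T (lp.single p j (1 : ℂ))‖ := by
  have h : ∑' j : ℤ, ‖T (lp.single p j (1 : ℂ))‖ₑ ≠ ∞ := by
    simp_rw [enorm_lp_eq hp, hT _ _]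
    exact hK.ne
  simpa using ENNReal.summable_toReal h

theorem exists_hasKernel (hp : p ≠ ∞) {K : ℤ → ℤ → ℂ}
    (hK : ∑' j : ℤ, (∑' m : ℤ, ‖K m j‖ₑ ^ p.toReal) ^ (1 / p.toReal) < ∞) :
    ∃ T : lp (fun _ : ℤ => ℂ) p →L[ℂ] lp (fun _ : ℤ => ℂ) p, HasKernel T K := by
  let y : ℤ → lp (fun _ : ℤ => ℂ) p := fun j =>
    ⟨fun m => K m j, memℓp_of_tsum_enorm_ne_top hp (ENNReal.ne_top_of_tsum_ne_top hK.ne j)⟩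
  have hy : ∑' j : ℤ, ‖y j‖ₑ ≠ ∞ := by
    simp_rw [enorm_lp_eq hp]
    exact hK.ne
  obtain ⟨T, hT⟩ := exists_apply_single_eq (y := y) (by simpa using ENNReal.summable_toReal hy)
  exact ⟨T, fun i j => by rw [hT]⟩

end Kernel

/-! ### Traces of powers as sums over closed chains. -/

section Chains

theorem summable_prod_comp_fin {ι : Type*} {a : ι → ℝ} (ha0 : ∀ i, 0 ≤ a i) (ha : Summable a)
    (m : ℕ) : Summable fun w : Fin m → ι => ∏ s, a (w s) := by
  induction m with
  | zero => exact Summable.of_finite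
  | succ m ih =>
    rw [← (Fin.consEquiv fun _ : Fin (m + 1) => ι).summable_iff]
    refine (ha.mul_of_nonneg ih ha0 fun w => Finset.prod_nonneg fun _ _ => ha0 _).congr
      fun q => ?_
    simp [Fin.consEquiv, Fin.prod_univ_succ]

/-- The product `K(i, g₀) K(g₀, g₁) ⋯ K(gₘ₋₁, gₘ)` along a path that starts at `i`. -/
def pathProd (K : ℤ → ℤ → ℂ) {m : ℕ} (i : ℤ) (g : Fin m → ℤ) : ℂ :=
  ∏ s, K ((Fin.cons i g : Fin (m + 1) → ℤ) s.castSucc) (g s)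

theorem pathProd_snoc (K : ℤ → ℤ → ℂ) {m : ℕ} (i j : ℤ) (g : Fin (m + 1) → ℤ) :
    pathProd K i (Fin.snoc g j : Fin (m + 2) → ℤ) = pathProd K i g * K (g (Fin.last m)) j := by
  rw [pathProd, Fin.prod_univ_castSucc, Fin.cons_snoc_eq_snoc_cons]
  simp only [Fin.snoc_castSucc, Fin.snoc_last]
  rw [← Fin.succ_last, Fin.cons_succ]
  rfl

/-- A closed chain is determined by its entries `j₁, …, jₘ`. -/
def closedChainEquiv (m : ℕ) : ClosedChain (m + 1) ≃ (Fin (m + 1) → ℤ) where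
  toFun j := Fin.tail j.1
  invFun g := ⟨Fin.cons (g (Fin.last m)) g, by rw [Fin.cons_zero, ← Fin.succ_last, Fin.cons_succ]⟩
  left_inv j := by
    refine Subtype.ext ?_
    change (Fin.cons (j.1 (Fin.last m).succ) (Fin.tail j.1) : Fin (m + 2) → ℤ) = j.1
    rw [Fin.succ_last, ← j.2, Fin.cons_self_tail]
  right_inv g := Fin.tail_cons _ _

theorem chainProd_closedChainEquiv_symm (K : ℤ → ℤ → ℂ) {m : ℕ} (g : Fin (m + 1) → ℤ) :
    chainProd K ((closedChainEquiv m).symm g) = pathProd K (g (Fin.last m)) g :=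
  Finset.prod_congr rfl fun _ _ => rfl

variable {K : ℤ → ℤ → ℂ} {a : ℤ → ℝ}

theorem norm_pathProd_le (hKa : ∀ i j, ‖K i j‖ ≤ a j) {m : ℕ} (i : ℤ) (g : Fin m → ℤ) :
    ‖pathProd K i g‖ ≤ ∏ s, a (g s) := by
  rw [pathProd, norm_prod]
  exact Finset.prod_le_prod (fun _ _ => norm_nonneg _) fun _ _ => hKa _ _

theorem summable_pathProd (hKa : ∀ i j, ‖K i j‖ ≤ a j) (ha : Summable a) (m : ℕ)
    (i : (Fin m → ℤ) → ℤ) : Summable fun g : Fin m → ℤ => pathProd K (i g) g :=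
  Summable.of_norm_bounded (summable_prod_comp_fin (fun j => (norm_nonneg _).trans (hKa 0 j)) ha m)
    fun g => norm_pathProd_le hKa (i g) g

theorem summable_chainProd (hKa : ∀ i j, ‖K i j‖ ≤ a j) (ha : Summable a) (m : ℕ) :
    Summable fun j : ClosedChain (m + 1) => chainProd K j := by
  rw [← (closedChainEquiv m).symm.summable_iff]
  exact (summable_pathProd hKa ha (m + 1) fun g => g (Fin.last m)).congr fun g =>
    chainProd_closedChainEquiv_symm K g

variable {p : ℝ≥0∞} [Fact (1 ≤ p)]

/-- Matrix multiplication by induction on the last step: paths are grouped by their penultimate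
vertex `k`, and absolute summability justifies the grouping. -/
theorem hasSum_pathProd (hp : p ≠ ∞) {T : lp (fun _ : ℤ => ℂ) p →L[ℂ] lp (fun _ : ℤ => ℂ) p}
    (hT : HasKernel T K) (hKa : ∀ i j, ‖K i j‖ ≤ a j) (ha : Summable a) (m : ℕ) (i j : ℤ) :
    HasSum (fun w : Fin m → ℤ => pathProd K i (Fin.snoc w j : Fin (m + 1) → ℤ))
      ((T ^ (m + 1)) (lp.single p j (1 : ℂ)) i) := by
  induction m generalizing j with
  | zero =>
    have h : (T ^ (0 + 1)) (lp.single p j (1 : ℂ)) i =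
        pathProd K i (Fin.snoc (default : Fin 0 → ℤ) j : Fin 1 → ℤ) := by
      rw [pow_one T, hT i j]
      simp [pathProd, Fin.snoc]
    rw [h]
    exact hasSum_unique fun w : Fin 0 → ℤ => pathProd K i (Fin.snoc w j : Fin 1 → ℤ)
  | succ m ih =>
    have hs : Summable fun w : Fin (m + 1) → ℤ =>
        pathProd K i (Fin.snoc w j : Fin (m + 2) → ℤ) := by
      simp_rw [pathProd_snoc]
      refine Summable.of_norm_bounded ((summable_prod_comp_fin
        (fun j => (norm_nonneg _).trans (hKa 0 j)) ha (m + 1)).mul_right (a j)) fun g => ?_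
      rw [norm_mul]
      exact mul_le_mul (norm_pathProd_le hKa i g) (hKa _ _) (norm_nonneg _)
        (Finset.prod_nonneg fun _ _ => (norm_nonneg _).trans (hKa 0 _))
    have hs' := (Fin.snocEquiv fun _ : Fin (m + 1) => ℤ).hasSum_iff.2 hs.hasSum
    have hfib := hs'.prod_fiberwise (g := fun k => (T ^ (m + 1)) (lp.single p k (1 : ℂ)) i * K k j)
      fun k => ((ih k).mul_right (K k j)).congr_fun fun w => by
        change pathProd K i (Fin.snoc (Fin.snoc w k : Fin (m + 1) → ℤ) j : Fin (m + 2) → ℤ) = _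
        rw [pathProd_snoc, Fin.snoc_last]
    have happly : HasSum (fun k => (T ^ (m + 1)) (lp.single p k (1 : ℂ)) i * K k j)
        ((T ^ (m + 1 + 1)) (lp.single p j (1 : ℂ)) i) := by
      rw [pow_succ T (m + 1), mul_apply_eq_comp]
      have h := (hasSum_apply_single_mul hp
        (lp.evalCLM ℂ (fun _ : ℤ => ℂ) p i ∘L T ^ (m + 1)) (T (lp.single p j (1 : ℂ))))
      refine h.congr_fun fun k => ?_
      rw [← hT k j]
      rfl
    rw [happly.unique hfib]
    exact hs.hasSum

theorem tsum_chainProd (hp : p ≠ ∞) {T : lp (fun _ : ℤ => ℂ) p →L[ℂ] lp (fun _ : ℤ => ℂ) p}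
    (hT : HasKernel T K) (hKa : ∀ i j, ‖K i j‖ ≤ a j) (ha : Summable a) (m : ℕ) :
    ∑' j : ClosedChain (m + 1), chainProd K j = diagTrace (T ^ (m + 1)) := by
  rw [← (closedChainEquiv m).symm.tsum_eq]
  simp_rw [chainProd_closedChainEquiv_symm]
  have hs := summable_pathProd hKa ha (m + 1) fun g => g (Fin.last m)
  -- Group the closed chains by their common endpoint `i`; each group sums to the `i`-th diagonal
  -- entry of `T ^ (m + 1)`.
  have hs' := (Fin.snocEquiv fun _ : Fin (m + 1) => ℤ).hasSum_iff.2 hs.hasSum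
  refine (hs'.prod_fiberwise (g := fun i => (T ^ (m + 1)) (lp.single p i (1 : ℂ)) i)
    fun i => (hasSum_pathProd hp hT hKa ha m i i).congr_fun fun w => ?_).tsum_eq.symm
  change pathProd K ((Fin.snoc w i : Fin (m + 1) → ℤ) (Fin.last m))
    (Fin.snoc w i : Fin (m + 1) → ℤ) = _
  rw [Fin.snoc_last]

theorem plemeljTerm_succ (hp : p ≠ ∞) {T : lp (fun _ : ℤ => ℂ) p →L[ℂ] lp (fun _ : ℤ => ℂ) p}
    (hT : HasKernel T K) (hKa : ∀ i j, ‖K i j‖ ≤ a j) (ha : Summable a) (z : ℂ) (m : ℕ) :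
    plemeljTerm K z (m + 1) = logDetTerm (z • T) m := by
  have h : diagTrace ((z • T) ^ (m + 1)) = z ^ (m + 1) * diagTrace (T ^ (m + 1)) := by
    rw [smul_pow, diagTrace, diagTrace, ← tsum_mul_left]
    rfl
  rw [plemeljTerm, logDetTerm, tsum_chainProd hp hT hKa ha, h, mul_assoc]

end Chains

end NuclearDet

end

theorem mainTheorem4 (p : ℝ≥0∞) [Fact (1 ≤ p)] (hp : p ≠ ∞) (K : ℤ → ℤ → ℂ)
    (hK : ∑' j : ℤ, (∑' m : ℤ, ‖K m j‖ₑ ^ p.toReal) ^ (1 / p.toReal) < ∞) :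
    (∃! T : lp (fun _ : ℤ => ℂ) p →L[ℂ] lp (fun _ : ℤ => ℂ) p, NuclearDet.HasKernel T K) ∧
    ∀ T : lp (fun _ : ℤ => ℂ) p →L[ℂ] lp (fun _ : ℤ => ℂ) p, NuclearDet.HasKernel T K →
      NuclearDet.IsNuclear T ∧
      (∀ m : ℕ, 1 ≤ m → Summable fun j : NuclearDet.ClosedChain m => NuclearDet.chainProd K j) ∧
      ∃ r : ℝ, 0 < r ∧ ∀ z : ℂ, ‖z‖ < r →
        Summable (fun n : ℕ => NuclearDet.plemeljTerm K z (n + 1)) ∧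
        NuclearDet.HasNuclearDet (z • T)
          (Complex.exp (∑' n : ℕ, NuclearDet.plemeljTerm K z (n + 1))) := by
  obtain ⟨T₀, hT₀⟩ := NuclearDet.exists_hasKernel hp hK
  refine ⟨⟨T₀, hT₀, fun U hU => NuclearDet.HasKernel.ext hp hU hT₀⟩, fun T hT => ?_⟩
  have ha := hT.summable_norm_apply_single hp hK
  have hKa : ∀ i j, ‖K i j‖ ≤ ‖T (lp.single p j (1 : ℂ))‖ := fun i j => by
    rw [← hT i j]
    exact lp.norm_apply_le_norm (zero_lt_one.trans_le Fact.out).ne' _ i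
  have hnuc := NuclearDet.isNuclear_of_summable_norm_apply_single hp ha
  -- This radius forces `‖z • T‖ < 1`; the `+ 1` covers `T = 0`.
  refine ⟨hnuc, fun m hm => ?_, (‖T‖ + 1)⁻¹, by positivity, fun z hz => ?_⟩
  · obtain ⟨m, rfl⟩ := Nat.exists_eq_add_of_le' hm
    exact NuclearDet.summable_chainProd hKa ha m
  · have hzT : ‖z • T‖ < 1 := by
      rw [norm_smul]
      calc ‖z‖ * ‖T‖ ≤ ‖z‖ * (‖T‖ + 1) := by gcongr; linarith
        _ < (‖T‖ + 1)⁻¹ * (‖T‖ + 1) := by gcongr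
        _ = 1 := inv_mul_cancel₀ (by positivity)
    simp_rw [NuclearDet.plemeljTerm_succ hp hT hKa ha z]
    exact ⟨(hnuc.smul z).summable_logDetTerm hp hzT, (hnuc.smul z).hasNuclearDet_exp hp hzT⟩
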